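/- Let $R$ be a commutative ring. For a quadratic module $(V,q)$ over $R$ let $\mathrm{Cl}(V,q)$ be its Clifford algebra ($x^2=q(x)$ for $x\in V$), $\mathrm{Cl}_0$ its even part, $x\mapsto x^*$ its standard involution (the anti-automorphism with $x^*=-x$ for $x \in V$), and $$\mathrm{Spin}(V,q)=\{x\in \mathrm{Cl}_0(V,q)^{\times} : xx^*=1,\ xVx^{-1}=V\}.$$ Let $H(R^3)=R^3\oplus R^3$ with $q(v,w)=v\cdot w^{\intercal}$, and let $\mathrm{Spin}_6(R)=\mathrm{Spin}(H(R^3))$, which acts on $H(R^3)$ by $g\bullet x=gxg^{-1}$. Let $e=(1,0,0,1,0,0)\in H(R^3)$, let $W=e^{\perp}=\{(a_1,a_2,a_3,b_1,b_2,b_3): a_1+b_1=0\}$ be its orthogonal complement, a free module of rank $5$ with the restricted form $q=-b_1^2+a_2b_2+a_3b_3$, and let $\mathrm{Spin}_5(R)=\mathrm{Spin}(W,q|_W)$. Let $Sp_4(R)=\{g\in M_4(R): g\Omega g^{\intercal}=\Omega\}$ with $\Omega=\begin{pmatrix}0&-I_2\\ I_2&0\end{pmatrix}$. For $v=(a_1,a_2,a_3)$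 and $w=(b_1,b_2,b_3)$ put $$\mathcal S(v,w)=\begin{pmatrix}a_1&0&a_2&a_3\\0&a_1&-b_3&b_2\\-b_2&a_3&b_1&0\\-b_3&-a_2&0&b_1\end{pmatrix},\qquad J=\begin{pmatrix}0&1&0&0\\-1&0&0&0\\0&0&0&-1\\0&0&1&0\end{pmatrix},$$ and $M^*=JM^{\intercal}J^{\intercal}$ for $M\in M_4(R)$. Then: 1. $\mathrm{Spin}_5(R)\cong Sp_4(R)$ as groups. 2. The homomorphism $\mathrm{Cl}(W,q|_W)\to\mathrm{Cl}(H(R^3))$ induced by the inclusion $W\subset H(R^3)$ maps $\mathrm{Spin}_5(R)$ injectively onto the stabiliser $\{g\in\mathrm{Spin}_6(R): g\bullet e=e\}$ of $e$. 3. There is a group isomorphism $\psi:\mathrm{Spin}_6(R)\to SL_4(R)$ such that $\mathcal S(g\bullet x)=\psi(g)\,\mathcal S(x)\,\psi(g)^*$ for all $g\in\mathrm{Spin}_6(R)$ and $x\in H(R^3)$, and $g\in\mathrm{Spin}_6(R)$ fixes $e$ if and only if $\psi(g)J\psi(g)^{\intercal}=J$. -/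

import Mathlib

open Matrix

/-- The quadratic form `q (v, w) = v ⬝ w` of the hyperbolic space `H(Rⁿ) = Rⁿ ⊕ Rⁿ`. -/
def hyperbolicForm (R : Type*) [CommRing R] (n : ℕ) :
    QuadraticForm R ((Fin n → R) × (Fin n → R)) :=
  LinearMap.BilinMap.toQuadraticMap
    (LinearMap.mk₂ R
      (fun x y : (Fin n → R) × (Fin n → R) => x.1 ⬝ᵥ y.2)
      (fun x x' y => by simp [add_dotProduct])
      (fun c x y => by simp [smul_dotProduct])
      (fun x y y' => by simp [dotProduct_add])
      (fun c x y => by simp [dotProduct_smul]))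

theorem hyperbolicForm_apply (R : Type*) [CommRing R] (n : ℕ)
    (x : (Fin n → R) × (Fin n → R)) :
    hyperbolicForm R n x = x.1 ⬝ᵥ x.2 := rfl

theorem star_mem_even {R : Type*} [CommRing R] {M : Type*} [AddCommGroup M] [Module R M]
    {Q : QuadraticForm R M} {x : CliffordAlgebra Q} (hx : x ∈ CliffordAlgebra.even Q) :
    star x ∈ CliffordAlgebra.even Q := by
  rw [CliffordAlgebra.star_def]
  exact (CliffordAlgebra.reverse_mem_evenOdd_iff Q).2
    ((CliffordAlgebra.involute_mem_evenOdd_iff Q).2 hx)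

/-- The spin group of a quadratic module `(M, Q)`:
`{x ∈ Cl₀(Q) | x x* = 1 and x M x⁻¹ = M}`, inside the unit group of the Clifford algebra.
Here `star` is the standard involution of the Clifford algebra (the anti-automorphism which is
`-1` on `M`). -/
def cliffordSpin {R : Type*} [CommRing R] {M : Type*} [AddCommGroup M] [Module R M]
    (Q : QuadraticForm R M) : Subgroup (CliffordAlgebra Q)ˣ where
  carrier := {x | (x : CliffordAlgebra Q) ∈ CliffordAlgebra.even Q ∧
    (x : CliffordAlgebra Q) * star (x : CliffordAlgebra Q) = 1 ∧
    (fun y : CliffordAlgebra Q => (x : CliffordAlgebra Q) * y * ((x⁻¹ : (CliffordAlgebra Q)ˣ) :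
      CliffordAlgebra Q)) '' Set.range (CliffordAlgebra.ι Q) = Set.range (CliffordAlgebra.ι Q)}
  one_mem' := ⟨one_mem _, by simp, by simp⟩
  mul_mem' := by
    rintro x y ⟨hx0, hx1, hx2⟩ ⟨hy0, hy1, hy2⟩
    refine ⟨?_, ?_, ?_⟩
    · rw [Units.val_mul]
      exact mul_mem hx0 hy0
    · rw [Units.val_mul, star_mul, mul_assoc, ← mul_assoc (y : CliffordAlgebra Q), hy1, one_mul,
        hx1]
    · conv_rhs => rw [← hx2, ← hy2, Set.image_image]
      refine Set.image_congr fun z _ => ?_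
      simp only [_root_.mul_inv_rev, Units.val_mul, mul_assoc]
  inv_mem' := by
    rintro x ⟨hx0, hx1, hx2⟩
    have h : ((x⁻¹ : (CliffordAlgebra Q)ˣ) : CliffordAlgebra Q) = star (x : CliffordAlgebra Q) :=
      Units.inv_eq_of_mul_eq_one_right hx1
    refine ⟨?_, ?_, ?_⟩
    · rw [h]
      exact star_mem_even hx0
    · rw [h, star_star, ← h, Units.inv_mul]
    · conv_lhs => rw [← hx2, Set.image_image]
      simp [mul_assoc]

/-- `Spin₆(R)`, the spin group of `H(R³)`. -/
abbrev Spin6 (R : Type*) [CommRing R] :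
    Subgroup (CliffordAlgebra (hyperbolicForm R 3))ˣ :=
  cliffordSpin (hyperbolicForm R 3)

/-- The point `(1, 0, 0, 1, 0, 0)` of the unit sphere of `H(R³)`. -/
def basePoint (R : Type*) [CommRing R] : (Fin 3 → R) × (Fin 3 → R) :=
  (![1, 0, 0], ![1, 0, 0])

/-- The orthogonal complement of the base point in `H(R³)`; a free module of rank five. -/
def basePointPerp (R : Type*) [CommRing R] : Submodule R ((Fin 3 → R) × (Fin 3 → R)) :=
  LinearMap.ker (QuadraticMap.polarBilin (hyperbolicForm R 3) (basePoint R))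

/-- The form of `H(R³)` restricted to the complement of the base point; in coordinates
`((-t, v), (t, w)) ↦ -t² + v ⬝ w`. -/
def form5 (R : Type*) [CommRing R] : QuadraticForm R (basePointPerp R) :=
  (hyperbolicForm R 3).comp (basePointPerp R).subtype

/-- `Spin₅(R)`, the spin group of the rank five quadratic module `form5`. -/
abbrev Spin5 (R : Type*) [CommRing R] : Subgroup (CliffordAlgebra (form5 R))ˣ :=
  cliffordSpin (form5 R)

/-- The inclusion of `form5` in `H(R³)`, as an isometry. -/
def form5Inclusion (R : Type*) [CommRing R] : form5 R →qᵢ hyperbolicForm R 3 where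
  toLinearMap := (basePointPerp R).subtype
  map_app' := fun _ => rfl

/-- The homomorphism of unit groups of Clifford algebras induced by the inclusion. -/
def form5Units (R : Type*) [CommRing R] :
    (CliffordAlgebra (form5 R))ˣ →* (CliffordAlgebra (hyperbolicForm R 3))ˣ :=
  Units.map (CliffordAlgebra.map (form5Inclusion R) :
    CliffordAlgebra (form5 R) →* CliffordAlgebra (hyperbolicForm R 3))

/-- The Suslin matrix `𝒮(v, w)` of a vector `(v, w)` of `H(R³)`. -/
def suslin {R : Type*} [CommRing R] (x : (Fin 3 → R) × (Fin 3 → R)) :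
    Matrix (Fin 4) (Fin 4) R :=
  !![x.1 0, 0, x.1 1, x.1 2;
     0, x.1 0, -x.2 2, x.2 1;
     -x.2 1, x.1 2, x.2 0, 0;
     -x.2 2, -x.1 1, 0, x.2 0]

/-- The alternating matrix `J`. -/
def suslinJ (R : Type*) [CommRing R] : Matrix (Fin 4) (Fin 4) R :=
  !![0, 1, 0, 0;
     -1, 0, 0, 0;
     0, 0, 0, -1;
     0, 0, 1, 0]

/-- The involution `M* = J Mᵀ Jᵀ` of the matrix ring. -/
def suslinStar {R : Type*} [CommRing R] (A : Matrix (Fin 4) (Fin 4) R) :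
    Matrix (Fin 4) (Fin 4) R :=
  suslinJ R * Aᵀ * (suslinJ R)ᵀ

/-- `g` takes the vector `x` to the vector `y`, that is `g x g⁻¹ = y` in the Clifford algebra. -/
def SpinMaps {R : Type*} [CommRing R] {M : Type*} [AddCommGroup M] [Module R M]
    {Q : QuadraticForm R M} (g : (CliffordAlgebra Q)ˣ) (x y : M) : Prop :=
  (g : CliffordAlgebra Q) * CliffordAlgebra.ι Q x *
    ((g⁻¹ : (CliffordAlgebra Q)ˣ) : CliffordAlgebra Q) = CliffordAlgebra.ι Q y

/-! The Suslin matrix `𝒮` and its companion `𝒮̄` satisfy `𝒮 𝒮̄ = 𝒮̄ 𝒮 = q`, so the block matrices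
with off-diagonal blocks `𝒮(x)`, `𝒮̄(x)` represent `Cl(H(R³))` on `R⁸`. This representation is an
isomorphism onto `M₈(R)`. It is onto because its image contains every matrix unit
(`suslinRep_surjective`). It is injective because the Clifford algebra is generated as a module by
64 elements, and a surjective endomorphism of `R⁶⁴` is injective. The same count shows that `Cl(W)`
embeds in `Cl(H(R³))`.

Even elements become pairs `(A, B)` of diagonal blocks, and the standard involution becomes `(A, B)
↦ (B*, A*)`. Hence `x x* = 1` means `A B* = 1`, so `A` determines `B`. Conjugation acts by `𝒮 ↦ A 𝒮
A*` and `𝒮̄ ↦ B 𝒮̄ B*`. Up to the factor `J`, Suslin matrices are the alternating matrices and `q`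
is minus the Pfaffian, so `A 𝒮 A*` is always a Suslin matrix. The two actions come from one map of
vectors exactly when `det A = 1`; this gives `Spin₆ ≅ SL₄` (`mem_Spin6_iff`).

Since `𝒮(e) = 1`, fixing `e` means `A A* = 1`, that is `A J Aᵀ = J`. Even elements of `Cl(W)`
commute with `e`, and conversely an even element commuting with `e` comes from `Cl₀(W)`
(`exists_even_map_eq_of_commute`). So `Spin₅` is the stabiliser of `e`, and a permutation of the
coordinates turns `J` into the standard symplectic form. -/

namespace CliffordAlgebra

/-! ### Clifford algebras: generators, parity and commutation with an orthogonal vector. -/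

section General

variable {R M N : Type*} [CommRing R] [AddCommGroup M] [Module R M] [AddCommGroup N] [Module R N]
  {P : QuadraticForm R N} {Q : QuadraticForm R M}

/-- Vectors generate the algebra, so stability under left multiplication by vectors makes `S` a left
ideal. -/
theorem mem_of_one_mem_of_ι_mul_mem {S : Submodule R (CliffordAlgebra Q)} (h1 : 1 ∈ S)
    (hS : ∀ m, ∀ x ∈ S, ι Q m * x ∈ S) (x : CliffordAlgebra Q) : x ∈ S := by
  suffices h : ∀ y ∈ S, x * y ∈ S by simpa using h 1 h1
  induction x using CliffordAlgebra.induction with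
  | algebraMap r => intro y hy; rw [← Algebra.smul_def]; exact S.smul_mem r hy
  | ι m => exact hS m
  | mul a b ha hb => intro y hy; rw [mul_assoc]; exact ha _ (hb _ hy)
  | add a b ha hb => intro y hy; rw [add_mul]; exact S.add_mem (ha _ hy) (hb _ hy)

/-- If `M` is spanned by the image of `N` and a vector `v`, then `Cl(M) = Cl(N) + v Cl(N)`. -/
theorem exists_eq_map_add_ι_mul_map (f : P →qᵢ Q) (v : M)
    (hf : ∀ m, ∃ n, ∃ r : R, m = f n + r • v) (x : CliffordAlgebra Q) :
    ∃ a b, x = map f a + ι Q v * map f b := by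
  let S : Submodule R (CliffordAlgebra Q) :=
    LinearMap.range ((map f).toLinearMap.coprod (LinearMap.mulLeft R (ι Q v) ∘ₗ (map f).toLinearMap))
  have key : x ∈ S := by
    refine mem_of_one_mem_of_ι_mul_mem (LinearMap.mem_range.2 ⟨(1, 0), by simp⟩) ?_ x
    rintro m _ ⟨⟨a, b⟩, rfl⟩
    obtain ⟨n, r, rfl⟩ := hf m
    -- Expand `(n + r v)(a + v b)` using `n v = polar(n, v) - v n` and `v² = Q v`, then collect the
    -- terms with and without a leading `v`.
    refine ⟨(ι P n * a + algebraMap R _ (QuadraticMap.polar Q (f n) v) * b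
      + algebraMap R _ (r * Q v) * b, r • a - ι P n * b), ?_⟩
    have h1 : ι Q (f n) * ι Q v = algebraMap R _ (QuadraticMap.polar Q (f n) v)
        - ι Q v * ι Q (f n) := by rw [ι_mul_ι_comm]
    have h2 := ι_sq_scalar Q v
    simp only [LinearMap.coprod_apply, AlgHom.toLinearMap_apply, LinearMap.comp_apply,
      LinearMap.mulLeft_apply, map_add, map_sub, map_mul, map_smul, AlgHom.commutes, map_apply_ι]
    simp only [add_mul, mul_add, ← mul_assoc, h1, sub_mul, smul_mul_assoc, h2]
    rw [← Algebra.smul_def r (algebraMap R (CliffordAlgebra Q) (Q v)), smul_mul_assoc]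
    abel
  obtain ⟨⟨a, b⟩, h⟩ := key
  exact ⟨a, b, h.symm⟩

/-- Splitting off one coordinate vector at a time doubles the number of generators. Only this upper
bound on the size is needed, not freeness. -/
theorem exists_surjective_of_pi (n : ℕ) (Q : QuadraticForm R (Fin n → R)) :
    ∃ f : (Fin (2 ^ n) → R) →ₗ[R] CliffordAlgebra Q, Function.Surjective f := by
  induction n with
  | zero =>
    refine ⟨Algebra.linearMap R _ ∘ₗ LinearMap.proj 0, fun x => ?_⟩
    induction x using CliffordAlgebra.induction with
    | algebraMap r => exact ⟨fun _ => r, by simp⟩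
    | ι m => exact ⟨0, by rw [Subsingleton.elim m 0, map_zero, map_zero]⟩
    | mul a b ha hb =>
      obtain ⟨a, rfl⟩ := ha
      obtain ⟨b, rfl⟩ := hb
      exact ⟨a * b, by simp⟩
    | add a b ha hb =>
      obtain ⟨a, rfl⟩ := ha
      obtain ⟨b, rfl⟩ := hb
      exact ⟨a + b, by simp⟩
  | succ n ih =>
    let i : (Fin n → R) →ₗ[R] (Fin (n + 1) → R) :=
      { toFun := fun v => Fin.cons 0 v
        map_add' := fun v w => by ext j; refine Fin.cases ?_ (fun j => ?_) j <;> simp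
        map_smul' := fun c v => by ext j; refine Fin.cases ?_ (fun j => ?_) j <;> simp }
    let f : Q.comp i →qᵢ Q := ⟨i, fun _ => rfl⟩
    obtain ⟨g, hg⟩ := ih (Q.comp i)
    let e : (Fin (2 ^ (n + 1)) → R) ≃ₗ[R] (Fin (2 ^ n) → R) × (Fin (2 ^ n) → R) :=
      (LinearEquiv.funCongrLeft R R (Fintype.equivOfCardEq (by simp; ring))).trans
        (LinearEquiv.sumArrowLequivProdArrow _ _ R R)
    refine ⟨(((map f).toLinearMap ∘ₗ g).coprod
      (LinearMap.mulLeft R (ι Q (Pi.single 0 1)) ∘ₗ (map f).toLinearMap ∘ₗ g)) ∘ₗ e.toLinearMap,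
      fun x => ?_⟩
    obtain ⟨a, b, rfl⟩ := exists_eq_map_add_ι_mul_map f (Pi.single 0 1)
      (fun m => ⟨fun j => m j.succ, m 0, by
        ext j
        change _ = (Fin.cons 0 (fun j => m j.succ) : Fin (n + 1) → R) j + _
        refine Fin.cases ?_ (fun j => ?_) j <;> simp⟩) x
    obtain ⟨a, rfl⟩ := hg a
    obtain ⟨b, rfl⟩ := hg b
    exact ⟨e.symm (a, b), by simp⟩

theorem exists_surjective_of_surjective {n : ℕ} (p : (Fin n → R) →ₗ[R] N)
    (hp : Function.Surjective p) :
    ∃ f : (Fin (2 ^ n) → R) →ₗ[R] CliffordAlgebra P, Function.Surjective f := by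
  let i : P.comp p →qᵢ P := ⟨p, fun _ => rfl⟩
  obtain ⟨g, hg⟩ := exists_surjective_of_pi n (P.comp p)
  exact ⟨(map i).toLinearMap ∘ₗ g, (map_surjective i hp).comp hg⟩

theorem star_map (f : P →qᵢ Q) (x : CliffordAlgebra P) : star (map f x) = map f (star x) := by
  induction x using CliffordAlgebra.induction with
  | algebraMap r => simp [star_algebraMap]
  | ι m => simp
  | mul a b ha hb => simp [ha, hb]
  | add a b ha hb => simp [ha, hb]

theorem map_mem_evenOdd (f : P →qᵢ Q) {n : ZMod 2} {x : CliffordAlgebra P}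
    (hx : x ∈ evenOdd P n) : map f x ∈ evenOdd Q n := by
  refine evenOdd_induction P n (motive := fun x _ => map f x ∈ evenOdd Q n) (fun v h => ?_)
    (fun x y _ _ h1 h2 => ?_) (fun m₁ m₂ x _ h => ?_) x hx
  · have : map f v ∈ (LinearMap.range (ι P) ^ n.val).map (map f).toLinearMap := ⟨v, h, rfl⟩
    rw [Submodule.map_pow, ← LinearMap.range_comp] at this
    refine Submodule.mem_iSup_of_mem ⟨n.val, by simp⟩
      (pow_le_pow_left' (M := Submodule R (CliffordAlgebra Q)) ?_ n.val this)
    rintro _ ⟨m, rfl⟩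
    exact ⟨f m, by simp⟩
  · rw [map_add]
    exact add_mem h1 h2
  · rw [map_mul, map_mul, map_apply_ι, map_apply_ι]
    exact zero_add n ▸ SetLike.mul_mem_graded (ι_mul_ι_mem_evenOdd_zero Q _ _) h

theorem exists_eq_even_add_odd (x : CliffordAlgebra Q) :
    ∃ a ∈ evenOdd Q 0, ∃ b ∈ evenOdd Q 1, x = a + b := by
  have : x ∈ evenOdd Q 0 ⊔ evenOdd Q 1 := by rw [(evenOdd_isCompl Q).sup_eq_top]; trivial
  obtain ⟨a, ha, b, hb, h⟩ := Submodule.mem_sup.1 this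
  exact ⟨a, ha, b, hb, h.symm⟩

theorem eq_zero_of_mem_even_of_mem_odd {x : CliffordAlgebra Q} (h0 : x ∈ evenOdd Q 0)
    (h1 : x ∈ evenOdd Q 1) : x = 0 :=
  Submodule.disjoint_def.1 (evenOdd_isCompl Q).disjoint x h0 h1

/-- An orthogonal vector anticommutes with each generator, and the sign this produces is
multiplicative. -/
theorem ι_mul_map_of_isOrtho (f : P →qᵢ Q) {e : M} (he : ∀ n, Q.IsOrtho e (f n))
    (x : CliffordAlgebra P) : ι Q e * map f x = map f (involute x) * ι Q e := by
  induction x using CliffordAlgebra.induction with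
  | algebraMap r => simp [Algebra.commutes]
  | ι m => simp [ι_mul_ι_comm_of_isOrtho (he m)]
  | mul a b ha hb => rw [map_mul, map_mul, map_mul, ← mul_assoc, ha, mul_assoc, hb, mul_assoc]
  | add a b ha hb => simp only [map_add, mul_add, add_mul, ha, hb]

/-- If `e` is orthogonal to `N` and pairs to `1` with `v`, where `N` and `v` span `M`, then an
even element commuting with `e` comes from the even Clifford algebra of `N`. -/
theorem exists_even_map_eq_of_commute (f : P →qᵢ Q) {e v : M} (he : ∀ n, Q.IsOrtho e (f n))
    (hev : QuadraticMap.polar Q e v = 1) (hf : ∀ m, ∃ n, ∃ r : R, m = f n + r • v)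
    {x : CliffordAlgebra Q} (hx : x ∈ evenOdd Q 0) (hc : ι Q e * x = x * ι Q e) :
    ∃ a ∈ evenOdd P 0, map f a = x := by
  obtain ⟨a, b, rfl⟩ := exists_eq_map_add_ι_mul_map f v hf x
  obtain ⟨a0, ha0, a1, ha1, rfl⟩ := exists_eq_even_add_odd a
  obtain ⟨b0, hb0, b1, hb1, rfl⟩ := exists_eq_even_add_odd b
  have hv0 : ι Q v * map f b1 ∈ evenOdd Q 0 :=
    SetLike.mul_mem_graded (i := (1 : ZMod 2)) (j := 1) (ι_mem_evenOdd_one Q v)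
      (map_mem_evenOdd f hb1)
  have hv1 : ι Q v * map f b0 ∈ evenOdd Q 1 :=
    SetLike.mul_mem_graded (i := (1 : ZMod 2)) (j := 0) (ι_mem_evenOdd_one Q v)
      (map_mem_evenOdd f hb0)
  -- These are the odd terms of the even element `x`, so their sum is both even and odd.
  have hodd : map f a1 + ι Q v * map f b0 = 0 := by
    refine eq_zero_of_mem_even_of_mem_odd ?_ (add_mem (map_mem_evenOdd f ha1) hv1)
    have := sub_mem hx (add_mem (map_mem_evenOdd f ha0) hv0)
    convert this using 1
    simp only [map_add, mul_add]
    abel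
  have hx' : map f (a0 + a1) + ι Q v * map f (b0 + b1) = map f a0 + ι Q v * map f b1 := by
    rw [← sub_eq_zero, ← hodd]
    simp only [map_add, mul_add]
    abel
  rw [hx'] at hc ⊢
  have hev' : ι Q e * ι Q v = 1 - ι Q v * ι Q e := by rw [ι_mul_ι_comm, hev, map_one]
  -- In `e v b₁ = b₁ - v e b₁` the last term is `+ v b₁ e`, as `b₁` is odd. So the commutator of `e`
  -- with `a₀ + v b₁` is exactly `b₁`.
  have hb : map f b1 = 0 := by
    rw [mul_add, add_mul, ι_mul_map_of_isOrtho f he, involute_eq_of_mem_even ha0, ← mul_assoc,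
      hev', sub_mul, mul_assoc, ι_mul_map_of_isOrtho f he, involute_eq_of_mem_odd hb1] at hc
    simpa [mul_assoc] using hc
  exact ⟨a0, ha0, by rw [hb, mul_zero, add_zero]⟩

end General

end CliffordAlgebra

/-! ### Identities for Suslin matrices and the involution `M*`. -/

section Matrices

variable {R : Type*} [CommRing R]

/-- The companion `𝒮̄` of the Suslin matrix, with `𝒮 𝒮̄ = q`. -/
def suslinBar (x : (Fin 3 → R) × (Fin 3 → R)) : Matrix (Fin 4) (Fin 4) R :=
  !![x.2 0, 0, -x.1 1, -x.1 2;
     0, x.2 0, x.2 2, -x.2 1;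
     x.2 1, -x.1 2, x.1 0, 0;
     x.2 2, x.1 1, 0, x.1 0]

theorem suslin_add (x y : (Fin 3 → R) × (Fin 3 → R)) : suslin (x + y) = suslin x + suslin y := by
  ext i j; fin_cases i <;> fin_cases j <;> simp [suslin, add_comm]

theorem suslin_smul (c : R) (x : (Fin 3 → R) × (Fin 3 → R)) : suslin (c • x) = c • suslin x := by
  ext i j; fin_cases i <;> fin_cases j <;> simp [suslin]

theorem suslinBar_add (x y : (Fin 3 → R) × (Fin 3 → R)) :
    suslinBar (x + y) = suslinBar x + suslinBar y := by
  ext i j; fin_cases i <;> fin_cases j <;> simp [suslinBar, add_comm]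

theorem suslinBar_smul (c : R) (x : (Fin 3 → R) × (Fin 3 → R)) :
    suslinBar (c • x) = c • suslinBar x := by
  ext i j; fin_cases i <;> fin_cases j <;> simp [suslinBar]

theorem suslin_mul_suslinBar (x : (Fin 3 → R) × (Fin 3 → R)) :
    suslin x * suslinBar x = hyperbolicForm R 3 x • (1 : Matrix (Fin 4) (Fin 4) R) := by
  ext i j; fin_cases i <;> fin_cases j <;>
    simp [suslin, suslinBar, mul_apply, Fin.sum_univ_four, hyperbolicForm_apply, dotProduct,
      Fin.sum_univ_three] <;> ring

theorem suslinBar_mul_suslin (x : (Fin 3 → R) × (Fin 3 → R)) :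
    suslinBar x * suslin x = hyperbolicForm R 3 x • (1 : Matrix (Fin 4) (Fin 4) R) := by
  ext i j; fin_cases i <;> fin_cases j <;>
    simp [suslin, suslinBar, mul_apply, Fin.sum_univ_four, hyperbolicForm_apply, dotProduct,
      Fin.sum_univ_three] <;> ring

theorem suslin_injective : Function.Injective (suslin (R := R)) := by
  intro x y h
  have h' := fun i j => congrFun (congrFun h i) j
  have h00 := h' 0 0
  have h02 := h' 0 2
  have h03 := h' 0 3
  have h22 := h' 2 2
  have h13 := h' 1 3
  have h12 := h' 1 2
  simp [suslin] at h00 h02 h03 h22 h13 h12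
  refine Prod.ext (funext fun i => ?_) (funext fun i => ?_) <;> fin_cases i <;> assumption

theorem suslin_basePoint : suslin (basePoint R) = 1 := by
  ext i j; fin_cases i <;> fin_cases j <;> simp [suslin, basePoint]

theorem suslinBar_basePoint : suslinBar (basePoint R) = 1 := by
  ext i j; fin_cases i <;> fin_cases j <;> simp [suslinBar, basePoint]

theorem suslinJ_transpose_mul_self : (suslinJ R)ᵀ * suslinJ R = 1 := by
  ext i j; fin_cases i <;> fin_cases j <;> simp [suslinJ, mul_apply, Fin.sum_univ_four]

theorem suslinJ_mul_transpose_self : suslinJ R * (suslinJ R)ᵀ = 1 := by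
  ext i j; fin_cases i <;> fin_cases j <;> simp [suslinJ, mul_apply, Fin.sum_univ_four]

theorem suslinJ_transpose : (suslinJ R)ᵀ = -suslinJ R := by
  ext i j; fin_cases i <;> fin_cases j <;> simp [suslinJ]

theorem suslinStar_mul (A B : Matrix (Fin 4) (Fin 4) R) :
    suslinStar (A * B) = suslinStar B * suslinStar A := by
  simp only [suslinStar, transpose_mul, Matrix.mul_assoc]
  rw [← Matrix.mul_assoc (suslinJ R)ᵀ (suslinJ R), suslinJ_transpose_mul_self, Matrix.one_mul]

theorem suslinStar_add (A B : Matrix (Fin 4) (Fin 4) R) :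
    suslinStar (A + B) = suslinStar A + suslinStar B := by
  simp [suslinStar, Matrix.mul_add, Matrix.add_mul]

theorem suslinStar_one : suslinStar (1 : Matrix (Fin 4) (Fin 4) R) = 1 := by
  simp [suslinStar, suslinJ_mul_transpose_self]

theorem suslinStar_smul (c : R) (A : Matrix (Fin 4) (Fin 4) R) :
    suslinStar (c • A) = c • suslinStar A := by
  simp [suslinStar]

theorem suslinStar_suslinStar (A : Matrix (Fin 4) (Fin 4) R) : suslinStar (suslinStar A) = A := by
  simp only [suslinStar, transpose_mul, transpose_transpose]
  rw [suslinJ_transpose]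
  simp only [← Matrix.mul_assoc, Matrix.mul_neg, Matrix.neg_mul, neg_neg]
  have h : suslinJ R * suslinJ R = -1 := by
    rw [← suslinJ_mul_transpose_self, suslinJ_transpose, Matrix.mul_neg, neg_neg]
  rw [h, Matrix.mul_assoc, h]
  simp

theorem suslinStar_eq (A : Matrix (Fin 4) (Fin 4) R) : suslinStar A =
    !![A 1 1, -A 0 1, -A 3 1, A 2 1;
       -A 1 0, A 0 0, A 3 0, -A 2 0;
       -A 1 3, A 0 3, A 3 3, -A 2 3;
       A 1 2, -A 0 2, -A 3 2, A 2 2] := by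
  ext i j; fin_cases i <;> fin_cases j <;>
    simp [suslinStar, suslinJ, mul_apply, vecMul, dotProduct, Fin.sum_univ_four]

theorem suslinStar_suslin (x : (Fin 3 → R) × (Fin 3 → R)) : suslinStar (suslin x) = suslin x := by
  rw [suslinStar_eq]
  ext i j; fin_cases i <;> fin_cases j <;> simp [suslin]

theorem suslinStar_suslinBar (x : (Fin 3 → R) × (Fin 3 → R)) :
    suslinStar (suslinBar x) = suslinBar x := by
  rw [suslinStar_eq]
  ext i j; fin_cases i <;> fin_cases j <;> simp [suslinBar]

theorem det_suslinStar (A : Matrix (Fin 4) (Fin 4) R) : (suslinStar A).det = A.det := by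
  rw [suslinStar, det_mul, det_mul, det_transpose, mul_comm, ← mul_assoc, ← det_mul,
    suslinJ_transpose_mul_self, det_one, one_mul]

/-- The vector whose Suslin matrix is `M`, for `M` in the image of `suslin`. -/
def suslinCoord (M : Matrix (Fin 4) (Fin 4) R) : (Fin 3 → R) × (Fin 3 → R) :=
  (![M 0 0, M 0 2, M 0 3], ![M 2 2, M 1 3, -M 1 2])

/-- The matrices `𝒮(x) J` are exactly the alternating ones, and `A 𝒮 A* J = A (𝒮 J) Aᵀ` is again
alternating. -/
theorem suslin_suslinCoord (A : Matrix (Fin 4) (Fin 4) R) (x : (Fin 3 → R) × (Fin 3 → R)) :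
    suslin (suslinCoord (A * suslin x * suslinStar A)) = A * suslin x * suslinStar A := by
  rw [suslinStar_eq]
  ext i j; fin_cases i <;> fin_cases j <;>
    simp only [Fin.zero_eta, Fin.mk_one, Fin.reduceFinMk, suslin,
      suslinCoord, mul_apply, Fin.sum_univ_four, of_apply, cons_val', cons_val] <;>
    ring

/-- A form of `Pf(A X Aᵀ) = det A · Pf X`, with `𝒮̄` as the Pfaffian adjoint of `𝒮`. As a polynomial
identity it needs no invertibility of `A`. -/
theorem suslinStar_mul_suslinBar_mul (A : Matrix (Fin 4) (Fin 4) R)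
    (x : (Fin 3 → R) × (Fin 3 → R)) :
    suslinStar A * suslinBar (suslinCoord (A * suslin x * suslinStar A)) * A =
      A.det • suslinBar x := by
  have hdet : A.det = _ := det_succ_row_zero A
  simp only [det_fin_three, Fin.sum_univ_four, submatrix_apply, Fin.succAbove] at hdet
  simp [Fin.lt_def] at hdet
  rw [suslinStar_eq, hdet]
  ext i j; fin_cases i <;> fin_cases j <;>
    simp only [Fin.zero_eta, Fin.mk_one, Fin.reduceFinMk, suslin,
      suslinBar, suslinCoord, mul_apply, Fin.sum_univ_four, of_apply, cons_val',
      cons_val, Matrix.smul_apply, smul_eq_mul] <;>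
    ring

end Matrices

/-! ### The representation on `8 × 8` matrices and its bijectivity. -/

section SuslinRep

variable {R : Type*} [CommRing R]

/-- The matrix representation of `H(R³)` on block matrices. -/
def suslinBlock (R : Type*) [CommRing R] :
    (Fin 3 → R) × (Fin 3 → R) →ₗ[R] Matrix (Fin 4 ⊕ Fin 4) (Fin 4 ⊕ Fin 4) R where
  toFun x := fromBlocks 0 (suslin x) (suslinBar x) 0
  map_add' x y := by simp [suslin_add, suslinBar_add, fromBlocks_add]
  map_smul' c x := by simp [suslin_smul, suslinBar_smul, fromBlocks_smul]

/-- The representation of the Clifford algebra of `H(R³)` by `8 × 8` matrices. -/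
def suslinRep (R : Type*) [CommRing R] :
    CliffordAlgebra (hyperbolicForm R 3) →ₐ[R] Matrix (Fin 4 ⊕ Fin 4) (Fin 4 ⊕ Fin 4) R :=
  CliffordAlgebra.lift _ ⟨suslinBlock R, fun x => by
    simp [suslinBlock, fromBlocks_multiply, suslin_mul_suslinBar, suslinBar_mul_suslin,
      Algebra.algebraMap_eq_smul_one, ← fromBlocks_one, fromBlocks_smul]⟩

theorem suslinRep_ι (x : (Fin 3 → R) × (Fin 3 → R)) :
    suslinRep R (CliffordAlgebra.ι _ x) = fromBlocks 0 (suslin x) (suslinBar x) 0 :=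
  CliffordAlgebra.lift_ι_apply _ _ _

theorem suslinRep_ι_mul_ι (x y : (Fin 3 → R) × (Fin 3 → R)) :
    suslinRep R (CliffordAlgebra.ι _ x * CliffordAlgebra.ι _ y) =
      fromBlocks (suslin x * suslinBar y) 0 0 (suslinBar x * suslin y) := by
  rw [map_mul, suslinRep_ι, suslinRep_ι, fromBlocks_multiply]
  simp

/-- For a hyperbolic pair `eᵢ`, `fᵢ` the product `eᵢ fᵢ` is idempotent, and here it is diagonal. -/
theorem diagonal_mem_range_suslinRep (i : Fin 3) :
    diagonal (Sum.elim (![![1, 1, 0, 0], ![1, 0, 0, 1], ![1, 0, 1, 0]] i)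
      (![![0, 0, 1, 1], ![1, 0, 0, 1], ![1, 0, 1, 0]] i)) ∈ (suslinRep R).range := by
  refine ⟨CliffordAlgebra.ι _ (Pi.single i 1, 0) * CliffordAlgebra.ι _ (0, Pi.single i 1), ?_⟩
  change suslinRep R _ = _
  rw [suslinRep_ι_mul_ι, ← fromBlocks_diagonal]
  congr 1
  · ext j k
    fin_cases i <;> fin_cases j <;> fin_cases k <;>
      simp [suslin, suslinBar, mul_apply, Fin.sum_univ_four]
  · ext j k
    fin_cases i <;> fin_cases j <;> fin_cases k <;>
      simp [suslin, suslinBar, mul_apply, Fin.sum_univ_four]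

/-- The three commuting idempotents `pᵢ` and their complements `1 - pᵢ` have eight triple products,
which are the diagonal matrix units. -/
theorem single_self_mem_range_suslinRep (i : Fin 4 ⊕ Fin 4) :
    single i i (1 : R) ∈ (suslinRep R).range := by
  let S : Subalgebra R (Fin 4 ⊕ Fin 4 → R) := (suslinRep R).range.comap (diagonalAlgHom R)
  have h0 : _ ∈ S := diagonal_mem_range_suslinRep (R := R) 0
  have h1 : _ ∈ S := diagonal_mem_range_suslinRep (R := R) 1
  have h2 : _ ∈ S := diagonal_mem_range_suslinRep (R := R) 2
  rw [← diagonal_single]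
  change Pi.single i 1 ∈ S
  have h : ∀ f g h : Fin 4 ⊕ Fin 4 → R, f ∈ S → g ∈ S → h ∈ S → Pi.single i 1 = f * g * h →
      Pi.single i 1 ∈ S := fun f g h hf hg hh he => he ▸ mul_mem (mul_mem hf hg) hh
  have g0 := sub_mem S.one_mem h0
  have g1 := sub_mem S.one_mem h1
  have g2 := sub_mem S.one_mem h2
  rcases i with i | i <;> fin_cases i
  · refine h _ _ _ h0 h1 h2 ?_
    ext (j | j) <;> fin_cases j <;> simp
  · refine h _ _ _ h0 g1 g2 ?_
    ext (j | j) <;> fin_cases j <;> simp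
  · refine h _ _ _ g0 g1 h2 ?_
    ext (j | j) <;> fin_cases j <;> simp
  · refine h _ _ _ g0 h1 g2 ?_
    ext (j | j) <;> fin_cases j <;> simp
  · refine h _ _ _ g0 h1 h2 ?_
    ext (j | j) <;> fin_cases j <;> simp
  · refine h _ _ _ g0 g1 g2 ?_
    ext (j | j) <;> fin_cases j <;> simp
  · refine h _ _ _ h0 g1 h2 ?_
    ext (j | j) <;> fin_cases j <;> simp
  · refine h _ _ _ h0 h1 g2 ?_
    ext (j | j) <;> fin_cases j <;> simp

theorem single_mem_range_suslinRep_of_entry {i j : Fin 4 ⊕ Fin 4}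
    (x : (Fin 3 → R) × (Fin 3 → R))
    (h : fromBlocks 0 (suslin x) (suslinBar x) 0 i j = 1) :
    single i j (1 : R) ∈ (suslinRep R).range := by
  have := mul_mem (mul_mem (single_self_mem_range_suslinRep i)
    ⟨CliffordAlgebra.ι _ x, suslinRep_ι x⟩) (single_self_mem_range_suslinRep j)
  rw [single_mul_mul_single, h] at this
  simpa using this

theorem single_mem_range_suslinRep_trans {i j k : Fin 4 ⊕ Fin 4}
    (h : single i j (1 : R) ∈ (suslinRep R).range)
    (h' : single j k (1 : R) ∈ (suslinRep R).range) :
    single i k (1 : R) ∈ (suslinRep R).range := by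
  simpa using mul_mem h h'

theorem single_inl_inr_zero_mem_range_suslinRep (i : Fin 4) :
    single (Sum.inl 0) (Sum.inr i) (1 : R) ∈ (suslinRep R).range ∧
      single (Sum.inr i) (Sum.inl 0) (1 : R) ∈ (suslinRep R).range := by
  have aux : ∀ k, k ≠ 1 → single (Sum.inl 0) (Sum.inr k) (1 : R) ∈ (suslinRep R).range ∧
      single (Sum.inr k) (Sum.inl 0) (1 : R) ∈ (suslinRep R).range := by
    intro k hk
    fin_cases k
    · exact ⟨single_mem_range_suslinRep_of_entry (![1, 0, 0], 0) (by simp [suslin]),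
        single_mem_range_suslinRep_of_entry (0, ![1, 0, 0]) (by simp [suslinBar])⟩
    · exact absurd rfl hk
    · exact ⟨single_mem_range_suslinRep_of_entry (![0, 1, 0], 0) (by simp [suslin]),
        single_mem_range_suslinRep_of_entry (0, ![0, 1, 0]) (by simp [suslinBar])⟩
    · exact ⟨single_mem_range_suslinRep_of_entry (![0, 0, 1], 0) (by simp [suslin]),
        single_mem_range_suslinRep_of_entry (0, ![0, 0, 1]) (by simp [suslinBar])⟩
  by_cases hi : i = 1
  · subst hi
    -- The entry `(0, 1)` of `𝒮` and the entry `(1, 0)` of `𝒮̄` always vanish, so this index is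
    -- reached by a detour through the index 2 of both blocks.
    refine ⟨single_mem_range_suslinRep_trans (aux 2 (by decide)).1
      (single_mem_range_suslinRep_trans (j := Sum.inl 2)
        (single_mem_range_suslinRep_of_entry (![1, 0, 0], 0) (by simp [suslinBar]))
        (single_mem_range_suslinRep_of_entry (![0, 0, 1], 0) (by simp [suslin]))),
      single_mem_range_suslinRep_trans (j := Sum.inl 2)
        (single_mem_range_suslinRep_of_entry (0, ![0, 0, 1]) (by simp [suslinBar]))
        (single_mem_range_suslinRep_trans
        (single_mem_range_suslinRep_of_entry (0, ![1, 0, 0]) (by simp [suslin]))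
        (aux 2 (by decide)).2)⟩
  · exact aux i hi

theorem single_inl_inl_zero_mem_range_suslinRep (i : Fin 4) :
    single (Sum.inl 0) (Sum.inl i) (1 : R) ∈ (suslinRep R).range ∧
      single (Sum.inl i) (Sum.inl 0) (1 : R) ∈ (suslinRep R).range := by
  have aux : ∀ k : Fin 4, ∀ x y : (Fin 3 → R) × (Fin 3 → R),
      fromBlocks 0 (suslin x) (suslinBar x) 0 (Sum.inr k) (Sum.inl i) = 1 →
      fromBlocks 0 (suslin y) (suslinBar y) 0 (Sum.inl i) (Sum.inr k) = 1 → _ := fun k x y hx hy =>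
    And.intro
      (single_mem_range_suslinRep_trans (single_inl_inr_zero_mem_range_suslinRep k).1
        (single_mem_range_suslinRep_of_entry x hx))
      (single_mem_range_suslinRep_trans (single_mem_range_suslinRep_of_entry y hy)
        (single_inl_inr_zero_mem_range_suslinRep k).2)
  fin_cases i
  · exact aux 0 (0, ![1, 0, 0]) (![1, 0, 0], 0) (by simp [suslinBar]) (by simp [suslin])
  · exact aux 1 (0, ![1, 0, 0]) (![1, 0, 0], 0) (by simp [suslinBar]) (by simp [suslin])
  · exact aux 2 (![1, 0, 0], 0) (0, ![1, 0, 0]) (by simp [suslinBar]) (by simp [suslin])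
  · exact aux 3 (![1, 0, 0], 0) (0, ![1, 0, 0]) (by simp [suslinBar]) (by simp [suslin])

theorem suslinRep_surjective : Function.Surjective (suslinRep R) := by
  have h : ∀ i j, single i j (1 : R) ∈ (suslinRep R).range := by
    have h0 : ∀ i : Fin 4 ⊕ Fin 4, single (Sum.inl 0) i (1 : R) ∈ (suslinRep R).range ∧
        single i (Sum.inl 0) (1 : R) ∈ (suslinRep R).range := by
      rintro (i | i)
      · exact single_inl_inl_zero_mem_range_suslinRep i
      · exact single_inl_inr_zero_mem_range_suslinRep i
    exact fun i j => single_mem_range_suslinRep_trans (h0 i).2 (h0 j).1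
  intro M
  change M ∈ (suslinRep R).range
  rw [matrix_eq_sum_single M]
  refine sum_mem fun i _ => sum_mem fun j _ => ?_
  have := (suslinRep R).range.smul_mem (h i j) (M i j)
  simpa using this

theorem suslinRep_map_evenOdd_zero {x : CliffordAlgebra (hyperbolicForm R 3)}
    (hx : x ∈ CliffordAlgebra.evenOdd _ 0) :
    ∃ A B, suslinRep R x = fromBlocks A 0 0 B := by
  refine CliffordAlgebra.even_induction _ (motive := fun x _ => ∃ A B, suslinRep R x =
    fromBlocks A 0 0 B) (fun r => ⟨r • 1, r • 1, ?_⟩) ?_ ?_ x hx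
  · rw [AlgHom.commutes, Algebra.algebraMap_eq_smul_one, ← fromBlocks_one, fromBlocks_smul]
    simp
  · rintro x y _ _ ⟨A, B, h⟩ ⟨A', B', h'⟩
    exact ⟨A + A', B + B', by rw [map_add, h, h', fromBlocks_add]; simp⟩
  · rintro u v x _ ⟨A, B, h⟩
    exact ⟨_, _, by rw [map_mul, suslinRep_ι_mul_ι, h, fromBlocks_multiply]; simp; exact ⟨rfl, rfl⟩⟩

theorem suslinRep_map_evenOdd_one {x : CliffordAlgebra (hyperbolicForm R 3)}
    (hx : x ∈ CliffordAlgebra.evenOdd _ 1) :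
    ∃ A B, suslinRep R x = fromBlocks 0 A B 0 := by
  refine CliffordAlgebra.odd_induction _ (P := fun x _ => ∃ A B, suslinRep R x =
    fromBlocks 0 A B 0) (fun v => ⟨_, _, suslinRep_ι v⟩) ?_ ?_ x hx
  · rintro x y _ _ ⟨A, B, h⟩ ⟨A', B', h'⟩
    exact ⟨A + A', B + B', by rw [map_add, h, h', fromBlocks_add]; simp⟩
  · rintro u v x _ ⟨A, B, h⟩
    exact ⟨_, _, by rw [map_mul, suslinRep_ι_mul_ι, h, fromBlocks_multiply]; simp; exact ⟨rfl, rfl⟩⟩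

/-- Both sides are anti-multiplicative in `x`, and they agree on vectors because `𝒮* = 𝒮` and `𝒮̄* =
𝒮̄`. -/
theorem suslinRep_star (x : CliffordAlgebra (hyperbolicForm R 3))
    (A B C D : Matrix (Fin 4) (Fin 4) R) (hx : suslinRep R x = fromBlocks A B C D) :
    suslinRep R (star x) =
      fromBlocks (suslinStar D) (-suslinStar B) (-suslinStar C) (suslinStar A) := by
  induction x using CliffordAlgebra.induction generalizing A B C D with
  | algebraMap r =>
    rw [CliffordAlgebra.star_algebraMap, hx]
    rw [AlgHom.commutes, Algebra.algebraMap_eq_smul_one, ← fromBlocks_one, fromBlocks_smul,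
      fromBlocks_inj] at hx
    obtain ⟨rfl, rfl, rfl, rfl⟩ := hx
    simp only [suslinStar_smul, suslinStar_one]
    simp [suslinStar]
  | ι v =>
    rw [CliffordAlgebra.star_ι, map_neg, hx]
    rw [suslinRep_ι, fromBlocks_inj] at hx
    obtain ⟨rfl, rfl, rfl, rfl⟩ := hx
    simp only [suslinStar_suslin, suslinStar_suslinBar, fromBlocks_neg]
    simp [suslinStar]
  | mul a b ha hb =>
    have ha' := ha _ _ _ _ (fromBlocks_toBlocks _).symm
    have hb' := hb _ _ _ _ (fromBlocks_toBlocks _).symm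
    rw [map_mul, ← fromBlocks_toBlocks (suslinRep R a), ← fromBlocks_toBlocks (suslinRep R b),
      fromBlocks_multiply, fromBlocks_inj] at hx
    obtain ⟨rfl, rfl, rfl, rfl⟩ := hx
    rw [star_mul, map_mul, ha', hb', fromBlocks_multiply]
    simp only [suslinStar_add, suslinStar_mul, Matrix.neg_mul, Matrix.mul_neg, neg_neg, neg_add]
    congr 1 <;> abel
  | add a b ha hb =>
    have ha' := ha _ _ _ _ (fromBlocks_toBlocks _).symm
    have hb' := hb _ _ _ _ (fromBlocks_toBlocks _).symm
    rw [map_add, ← fromBlocks_toBlocks (suslinRep R a), ← fromBlocks_toBlocks (suslinRep R b),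
      fromBlocks_add, fromBlocks_inj] at hx
    obtain ⟨rfl, rfl, rfl, rfl⟩ := hx
    rw [star_add, map_add, ha', hb', fromBlocks_add]
    simp only [suslinStar_add, neg_add]

/-! ### The complement of the base point, and injectivity by counting generators. -/

theorem polar_basePoint (x : (Fin 3 → R) × (Fin 3 → R)) :
    QuadraticMap.polar (hyperbolicForm R 3) (basePoint R) x = x.1 0 + x.2 0 := by
  simp [QuadraticMap.polar, hyperbolicForm_apply, basePoint, dotProduct, Fin.sum_univ_three]
  ring

theorem mem_basePointPerp {x : (Fin 3 → R) × (Fin 3 → R)} :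
    x ∈ basePointPerp R ↔ x.1 0 + x.2 0 = 0 := by
  rw [← polar_basePoint]
  rfl

/-- A parametrisation of the complement of the base point. -/
def basePointPerpParam (R : Type*) [CommRing R] : (Fin 5 → R) →ₗ[R] basePointPerp R :=
  LinearMap.codRestrict (basePointPerp R)
    { toFun := fun c => (![-c 0, c 1, c 2], ![c 0, c 3, c 4])
      map_add' := fun c d => by
        refine Prod.ext ?_ ?_ <;> funext i <;> fin_cases i <;> simp [add_comm]
      map_smul' := fun r c => by
        refine Prod.ext ?_ ?_ <;> funext i <;> fin_cases i <;> simp }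
    fun c => mem_basePointPerp.2 (by simp)

theorem basePointPerpParam_surjective : Function.Surjective (basePointPerpParam R) := by
  rintro ⟨x, hx⟩
  rw [mem_basePointPerp] at hx
  refine ⟨![x.2 0, x.1 1, x.1 2, x.2 1, x.2 2], Subtype.ext (Prod.ext ?_ ?_)⟩ <;> funext i <;>
    fin_cases i <;> simp [basePointPerpParam]
  linear_combination -hx

/-- The extra vector pairs to 1 with `e`. The vector `e` itself would not do: it pairs to 2 with
itself, and 2 need not be invertible. -/
theorem exists_eq_form5Inclusion_add_smul (x : (Fin 3 → R) × (Fin 3 → R)) :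
    ∃ y, ∃ r : R, x = form5Inclusion R y + r • ((![1, 0, 0], 0) : (Fin 3 → R) × (Fin 3 → R)) := by
  refine ⟨⟨x - (x.1 0 + x.2 0) • (![1, 0, 0], 0), ?_⟩, x.1 0 + x.2 0, ?_⟩
  · rw [mem_basePointPerp]
    simp
  · exact (sub_add_cancel _ _).symm

theorem suslinRep_injective_and_map_injective :
    Function.Injective (suslinRep R) ∧
      Function.Injective (CliffordAlgebra.map (form5Inclusion R)) := by
  obtain ⟨g, hg⟩ := CliffordAlgebra.exists_surjective_of_surjective (P := form5 R)
    (basePointPerpParam R) basePointPerpParam_surjective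
  let m := (CliffordAlgebra.map (form5Inclusion R)).toLinearMap
  let L : (Fin (2 ^ 5) → R) × (Fin (2 ^ 5) → R) →ₗ[R] CliffordAlgebra (hyperbolicForm R 3) :=
    (m ∘ₗ g).coprod (LinearMap.mulLeft R (CliffordAlgebra.ι _ (![1, 0, 0], 0)) ∘ₗ m ∘ₗ g)
  have hL : Function.Surjective L := by
    intro x
    obtain ⟨a, b, rfl⟩ := CliffordAlgebra.exists_eq_map_add_ι_mul_map (form5Inclusion R)
      (![1, 0, 0], 0) exists_eq_form5Inclusion_add_smul x
    obtain ⟨a, rfl⟩ := hg a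
    obtain ⟨b, rfl⟩ := hg b
    exact ⟨(a, b), by simp [L, m]⟩
  let e : Matrix (Fin 4 ⊕ Fin 4) (Fin 4 ⊕ Fin 4) R ≃ₗ[R] (Fin (2 ^ 5) → R) × (Fin (2 ^ 5) → R) :=
    ((LinearEquiv.curry R R (Fin 4 ⊕ Fin 4) (Fin 4 ⊕ Fin 4)).symm.trans
      (LinearEquiv.funCongrLeft R R (Fintype.equivOfCardEq (by simp)))).trans
        (LinearEquiv.sumArrowLequivProdArrow _ _ R R)
  -- `Cl(W)` has 32 generators, so `L` is defined on `R⁶⁴`, the rank of `M₈(R)`. The composite is a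
  -- surjective endomorphism, hence injective, and so are its factors.
  have hinj : Function.Injective (e.toLinearMap ∘ₗ (suslinRep R).toLinearMap ∘ₗ L) :=
    OrzechProperty.injective_of_surjective_endomorphism _
      (e.surjective.comp (suslinRep_surjective.comp hL))
  have hinj' : Function.Injective ((suslinRep R) ∘ L) := fun x y h => hinj (congrArg e h)
  have hLinj : Function.Injective L := hinj'.of_comp
  refine ⟨?_, ?_⟩
  · intro x y h
    obtain ⟨x, rfl⟩ := hL x
    obtain ⟨y, rfl⟩ := hL y
    exact congrArg L (hinj' h)
  · intro x y h
    obtain ⟨x, rfl⟩ := hg x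
    obtain ⟨y, rfl⟩ := hg y
    have : L (x, 0) = L (y, 0) := by simpa [L, m] using h
    exact congrArg g (congrArg Prod.fst (hLinj this))

theorem suslinRep_injective : Function.Injective (suslinRep R) :=
  suslinRep_injective_and_map_injective.1

theorem map_form5Inclusion_injective :
    Function.Injective (CliffordAlgebra.map (form5Inclusion R)) :=
  suslinRep_injective_and_map_injective.2

theorem mem_evenOdd_zero_of_suslinRep_eq {x : CliffordAlgebra (hyperbolicForm R 3)}
    {A B : Matrix (Fin 4) (Fin 4) R} (hx : suslinRep R x = fromBlocks A 0 0 B) :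
    x ∈ CliffordAlgebra.evenOdd (hyperbolicForm R 3) 0 := by
  obtain ⟨a, ha, b, hb, rfl⟩ := CliffordAlgebra.exists_eq_even_add_odd x
  obtain ⟨C, D, h0⟩ := suslinRep_map_evenOdd_zero ha
  obtain ⟨E, F, h1⟩ := suslinRep_map_evenOdd_one hb
  rw [map_add, h0, h1, fromBlocks_add, fromBlocks_inj] at hx
  obtain ⟨-, hE, hF, -⟩ := hx
  rw [zero_add] at hE hF
  have : b = 0 := suslinRep_injective (by rw [h1, hE, hF, map_zero, fromBlocks_zero])
  rw [this, add_zero]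
  exact ha

end SuslinRep

/-! ### Spin groups in terms of matrices: `Spin₆` and `SL₄`. -/

section Spin

theorem image_conj_range_ι_eq {R M : Type*} [CommRing R] [AddCommGroup M] [Module R M]
    {Q : QuadraticForm R M} {g : (CliffordAlgebra Q)ˣ} (h : ∀ x, ∃ y, SpinMaps g x y)
    (h' : ∀ x, ∃ y, SpinMaps g⁻¹ x y) :
    (fun y : CliffordAlgebra Q => (g : CliffordAlgebra Q) * y * ((g⁻¹ : (CliffordAlgebra Q)ˣ) :
      CliffordAlgebra Q)) '' Set.range (CliffordAlgebra.ι Q) = Set.range (CliffordAlgebra.ι Q) := by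
  apply Set.Subset.antisymm
  · rintro _ ⟨_, ⟨x, rfl⟩, rfl⟩
    obtain ⟨y, hy⟩ := h x
    exact ⟨y, hy.symm⟩
  · rintro _ ⟨x, rfl⟩
    obtain ⟨y, hy⟩ := h' x
    refine ⟨_, ⟨y, rfl⟩, ?_⟩
    rw [← hy]
    simp [mul_assoc]

theorem exists_spinMaps_of_mem {R M : Type*} [CommRing R] [AddCommGroup M] [Module R M]
    {Q : QuadraticForm R M} {g : (CliffordAlgebra Q)ˣ} (hg : g ∈ cliffordSpin Q) (x : M) :
    ∃ y, SpinMaps g x y := by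
  obtain ⟨y, hy⟩ := hg.2.2.subset (Set.mem_image_of_mem _ (Set.mem_range_self x))
  exact ⟨y, hy.symm⟩

theorem spinMaps_self_iff {R M : Type*} [CommRing R] [AddCommGroup M] [Module R M]
    {Q : QuadraticForm R M} {g : (CliffordAlgebra Q)ˣ} {x : M} :
    SpinMaps g x x ↔ CliffordAlgebra.ι Q x * (g : CliffordAlgebra Q) = g * CliffordAlgebra.ι Q x := by
  rw [SpinMaps, Units.mul_inv_eq_iff_eq_mul, eq_comm]

/-- For vectors the anticommutator is the polar form, so a unit commuting with `e` preserves
orthogonality to `e`. -/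
theorem mul_conj_add_conj_mul_eq_zero {A : Type*} [Ring A] {g : Aˣ} {e y : A}
    (hg : e * g = g * e) (hy : e * y + y * e = 0) :
    e * (g * y * (g⁻¹ : Aˣ)) + g * y * (g⁻¹ : Aˣ) * e = 0 := by
  have hg' : (g⁻¹ : Aˣ) * e = e * (g⁻¹ : Aˣ) := by
    rw [Units.eq_mul_inv_iff_mul_eq, mul_assoc, hg, Units.inv_mul_cancel_left]
  calc _ = g * (e * y + y * e) * (g⁻¹ : Aˣ) := by
        rw [mul_assoc _ _ e, hg', mul_add, add_mul]
        simp only [← mul_assoc]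
        rw [hg]
    _ = 0 := by rw [hy, mul_zero, zero_mul]

theorem SpinMaps.inv {R M : Type*} [CommRing R] [AddCommGroup M] [Module R M]
    {Q : QuadraticForm R M} {g : (CliffordAlgebra Q)ˣ} {x y : M} (h : SpinMaps g x y) :
    SpinMaps g⁻¹ y x := by
  rw [SpinMaps, ← h]
  simp [mul_assoc]

variable {R : Type*} [CommRing R]

theorem suslinStar_mul_eq_one {A B : Matrix (Fin 4) (Fin 4) R} (h : A * suslinStar B = 1) :
    B * suslinStar A = 1 := by
  have := congrArg suslinStar h
  rwa [suslinStar_mul, suslinStar_suslinStar, suslinStar_one] at this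

theorem mul_suslinStar_self_eq_one_iff {A : Matrix (Fin 4) (Fin 4) R} :
    A * suslinStar A = 1 ↔ A * suslinJ R * Aᵀ = suslinJ R := by
  rw [suslinStar, ← Matrix.mul_assoc, ← Matrix.mul_assoc]
  constructor
  · intro h
    have := congrArg (· * suslinJ R) h
    simpa [Matrix.mul_assoc, suslinJ_transpose_mul_self] using this
  · intro h
    rw [h, suslinJ_mul_transpose_self]

theorem suslinCoord_eq_of_eq {A : Matrix (Fin 4) (Fin 4) R} {x y : (Fin 3 → R) × (Fin 3 → R)}
    (h : A * suslin x * suslinStar A = suslin y) :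
    suslinCoord (A * suslin x * suslinStar A) = y :=
  suslin_injective (by rw [suslin_suslinCoord, h])

theorem suslinBar_suslinCoord {A B : Matrix (Fin 4) (Fin 4) R} (h : A * suslinStar B = 1)
    (x : (Fin 3 → R) × (Fin 3 → R)) :
    suslinBar (suslinCoord (A * suslin x * suslinStar A)) =
      A.det • (B * suslinBar x * suslinStar B) := by
  have := congrArg (fun M => B * M * suslinStar B) (suslinStar_mul_suslinBar_mul A x)
  simp only [Matrix.mul_smul, Matrix.smul_mul] at this
  rw [← this]
  simp only [Matrix.mul_assoc, h, Matrix.mul_one]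
  rw [← Matrix.mul_assoc B (suslinStar A), suslinStar_mul_eq_one h, Matrix.one_mul]

/-- With `𝒮̄(e) = 1` the hypothesis on `B` gives `𝒮̄(y) = B B*`. Then `A* 𝒮̄(y) A` is both `det A ·
1` and `(A* B)(B* A) = 1`. -/
theorem det_eq_one_of_basePoint {A B : Matrix (Fin 4) (Fin 4) R} (h : A * suslinStar B = 1)
    {y : (Fin 3 → R) × (Fin 3 → R)} (hA : A * suslin (basePoint R) * suslinStar A = suslin y)
    (hB : B * suslinBar (basePoint R) * suslinStar B = suslinBar y) : A.det = 1 := by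
  have h1 := suslinStar_mul_suslinBar_mul A (basePoint R)
  have h2 := suslinStar_mul_eq_one (suslinStar_mul_eq_one h)
  rw [suslinCoord_eq_of_eq hA, ← hB, suslinBar_basePoint, Matrix.mul_one, Matrix.mul_assoc,
    Matrix.mul_assoc, mul_eq_one_comm.1 h, Matrix.mul_one,
    mul_eq_one_comm.1 (suslinStar_mul_eq_one h)] at h1
  have := congrFun (congrFun h1 0) 0
  simpa using this.symm

theorem mul_star_eq_one_iff_of_suslinRep_eq {x : CliffordAlgebra (hyperbolicForm R 3)}
    {A B : Matrix (Fin 4) (Fin 4) R} (hx : suslinRep R x = fromBlocks A 0 0 B) :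
    x * star x = 1 ↔ A * suslinStar B = 1 := by
  have h : suslinRep R (x * star x) = fromBlocks (A * suslinStar B) 0 0 (B * suslinStar A) := by
    rw [map_mul, suslinRep_star x _ _ _ _ hx, hx, fromBlocks_multiply]
    simp [suslinStar]
  rw [← suslinRep_injective.eq_iff, h, map_one, ← fromBlocks_one, fromBlocks_inj]
  exact ⟨fun h => h.1, fun h => ⟨h, rfl, rfl, suslinStar_mul_eq_one h⟩⟩

theorem suslinRep_inv {g : (CliffordAlgebra (hyperbolicForm R 3))ˣ}
    {A B : Matrix (Fin 4) (Fin 4) R} (hg : suslinRep R g = fromBlocks A 0 0 B)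
    (h : A * suslinStar B = 1) :
    suslinRep R ((g⁻¹ : (CliffordAlgebra (hyperbolicForm R 3))ˣ) :
      CliffordAlgebra (hyperbolicForm R 3)) = fromBlocks (suslinStar B) 0 0 (suslinStar A) := by
  rw [Units.inv_eq_of_mul_eq_one_right ((mul_star_eq_one_iff_of_suslinRep_eq hg).2 h),
    suslinRep_star _ _ _ _ _ hg]
  simp [suslinStar]

theorem spinMaps_iff {g : (CliffordAlgebra (hyperbolicForm R 3))ˣ}
    {A B : Matrix (Fin 4) (Fin 4) R} (hg : suslinRep R g = fromBlocks A 0 0 B)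
    (h : A * suslinStar B = 1) (x y : (Fin 3 → R) × (Fin 3 → R)) :
    SpinMaps g x y ↔ A * suslin x * suslinStar A = suslin y ∧
      B * suslinBar x * suslinStar B = suslinBar y := by
  rw [SpinMaps, ← suslinRep_injective.eq_iff, map_mul, map_mul, suslinRep_inv hg h, hg,
    suslinRep_ι, suslinRep_ι, fromBlocks_multiply, fromBlocks_multiply, fromBlocks_inj]
  simp

theorem exists_spinMaps_of_det_eq_one {g : (CliffordAlgebra (hyperbolicForm R 3))ˣ}
    {A B : Matrix (Fin 4) (Fin 4) R} (hg : suslinRep R g = fromBlocks A 0 0 B)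
    (h : A * suslinStar B = 1) (hA : A.det = 1) (x : (Fin 3 → R) × (Fin 3 → R)) :
    ∃ y, SpinMaps g x y :=
  ⟨suslinCoord (A * suslin x * suslinStar A), (spinMaps_iff hg h _ _).2
    ⟨(suslin_suslinCoord A x).symm, by rw [suslinBar_suslinCoord h, hA, one_smul]⟩⟩

/-- The action on the base point alone forces `det A = 1`. Conversely, determinant 1 makes the two
blocks act by the same map of vectors, for `g` and for its inverse. -/
theorem mem_Spin6_iff {g : (CliffordAlgebra (hyperbolicForm R 3))ˣ} :
    g ∈ Spin6 R ↔ ∃ A B, suslinRep R g = fromBlocks A 0 0 B ∧ A * suslinStar B = 1 ∧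
      A.det = 1 := by
  constructor
  · intro hg
    obtain ⟨A, B, h⟩ := suslinRep_map_evenOdd_zero hg.1
    have hAB := (mul_star_eq_one_iff_of_suslinRep_eq h).1 hg.2.1
    obtain ⟨y, hy⟩ := exists_spinMaps_of_mem hg (basePoint R)
    obtain ⟨h1, h2⟩ := (spinMaps_iff h hAB _ _).1 hy
    exact ⟨A, B, h, hAB, det_eq_one_of_basePoint hAB h1 h2⟩
  · rintro ⟨A, B, h, hAB, hA⟩
    have hB : B.det = 1 := by
      have := congrArg det hAB
      rwa [det_mul, hA, one_mul, det_suslinStar, det_one] at this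
    refine ⟨mem_evenOdd_zero_of_suslinRep_eq h, (mul_star_eq_one_iff_of_suslinRep_eq h).2 hAB,
      image_conj_range_ι_eq (exists_spinMaps_of_det_eq_one h hAB hA)
        (exists_spinMaps_of_det_eq_one (suslinRep_inv h hAB) ?_ ?_)⟩
    · rw [suslinStar_suslinStar]
      exact mul_eq_one_comm.1 hAB
    · rw [det_suslinStar, hB]

theorem suslinRep_of_mem_Spin6 {g : (CliffordAlgebra (hyperbolicForm R 3))ˣ} (hg : g ∈ Spin6 R) :
    ∃ B, suslinRep R g = fromBlocks (suslinRep R g).toBlocks₁₁ 0 0 B ∧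
      (suslinRep R g).toBlocks₁₁ * suslinStar B = 1 ∧ (suslinRep R g).toBlocks₁₁.det = 1 := by
  obtain ⟨A, B, h, hAB, hA⟩ := mem_Spin6_iff.1 hg
  have : (suslinRep R g).toBlocks₁₁ = A := by rw [h, toBlocks_fromBlocks₁₁]
  rw [this]
  exact ⟨B, h, hAB, hA⟩

/-- The homomorphism `Spin₆ → SL₄` given by the first half spin representation. -/
def spin6ToSL (R : Type*) [CommRing R] : Spin6 R →* SpecialLinearGroup (Fin 4) R where
  toFun g := ⟨(suslinRep R (g : (CliffordAlgebra (hyperbolicForm R 3))ˣ)).toBlocks₁₁,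
    (suslinRep_of_mem_Spin6 g.2).choose_spec.2.2⟩
  map_one' := by
    refine Subtype.ext ?_
    simp only [OneMemClass.coe_one, Units.val_one, map_one]
    rw [← fromBlocks_one, toBlocks_fromBlocks₁₁]
    rfl
  map_mul' g h := by
    refine Subtype.ext ?_
    obtain ⟨B, hB, -⟩ := suslinRep_of_mem_Spin6 g.2
    obtain ⟨C, hC, -⟩ := suslinRep_of_mem_Spin6 h.2
    change (suslinRep R ((g : (CliffordAlgebra (hyperbolicForm R 3))ˣ) *
      (h : (CliffordAlgebra (hyperbolicForm R 3))ˣ) : CliffordAlgebra _)).toBlocks₁₁ =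
      (suslinRep R (g : (CliffordAlgebra (hyperbolicForm R 3))ˣ)).toBlocks₁₁ *
        (suslinRep R (h : (CliffordAlgebra (hyperbolicForm R 3))ˣ)).toBlocks₁₁
    rw [Units.val_mul, map_mul, hB, hC, fromBlocks_multiply]
    simp

theorem exists_mem_Spin6_toBlocks_eq {A : Matrix (Fin 4) (Fin 4) R} (hA : A.det = 1) :
    ∃ g ∈ Spin6 R, (suslinRep R (g : CliffordAlgebra (hyperbolicForm R 3))).toBlocks₁₁ = A := by
  have h1 : A.adjugate * A = 1 := by rw [adjugate_mul, hA, one_smul]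
  have h2 : A * A.adjugate = 1 := by rw [mul_adjugate, hA, one_smul]
  have h3 := congrArg suslinStar h1
  have h4 := congrArg suslinStar h2
  rw [suslinStar_mul, suslinStar_one] at h3 h4
  -- The relation `A B* = 1` forces `B = (A⁻¹)*`, and `A⁻¹` is the adjugate.
  obtain ⟨x, hx⟩ := suslinRep_surjective (fromBlocks A 0 0 (suslinStar A.adjugate))
  obtain ⟨y, hy⟩ := suslinRep_surjective (fromBlocks A.adjugate 0 0 (suslinStar A))
  have hxy : x * y = 1 := suslinRep_injective (by
    rw [map_mul, hx, hy, fromBlocks_multiply, map_one, ← fromBlocks_one]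
    simp [h2, h4])
  have hyx : y * x = 1 := suslinRep_injective (by
    rw [map_mul, hx, hy, fromBlocks_multiply, map_one, ← fromBlocks_one]
    simp [h1, h3])
  refine ⟨⟨x, y, hxy, hyx⟩, mem_Spin6_iff.2 ⟨A, _, hx, ?_, hA⟩, ?_⟩
  · rw [suslinStar_suslinStar, h2]
  · rw [Units.val_mk, hx, toBlocks_fromBlocks₁₁]

theorem spin6ToSL_bijective : Function.Bijective (spin6ToSL R) := by
  constructor
  · intro g h hgh
    have hgh' : (suslinRep R (g : (CliffordAlgebra (hyperbolicForm R 3))ˣ)).toBlocks₁₁ =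
      (suslinRep R (h : (CliffordAlgebra (hyperbolicForm R 3))ˣ)).toBlocks₁₁ :=
      congrArg Subtype.val hgh
    obtain ⟨B, hB, hB1, -⟩ := suslinRep_of_mem_Spin6 g.2
    obtain ⟨C, hC, hC1, -⟩ := suslinRep_of_mem_Spin6 h.2
    rw [← hgh'] at hC1 hC
    refine Subtype.ext (Units.ext (suslinRep_injective ?_))
    rw [hB, hC]
    have h1 := mul_eq_one_comm.1 (suslinStar_mul_eq_one hB1)
    have h2 : B = C := by
      rw [← Matrix.mul_one B, ← mul_eq_one_comm.1 (suslinStar_mul_eq_one hC1),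
        ← Matrix.mul_assoc, suslinStar_mul_eq_one hB1, Matrix.one_mul]
    rw [h2]
  · rintro ⟨A, hA⟩
    obtain ⟨g, hg, h⟩ := exists_mem_Spin6_toBlocks_eq hA
    exact ⟨⟨g, hg⟩, Subtype.ext h⟩

/-- The isomorphism `Spin₆ ≃ SL₄`. -/
noncomputable def spin6EquivSL (R : Type*) [CommRing R] :
    Spin6 R ≃* SpecialLinearGroup (Fin 4) R :=
  MulEquiv.ofBijective (spin6ToSL R) spin6ToSL_bijective

theorem suslin_eq_of_spinMaps (g : Spin6 R) (x y : (Fin 3 → R) × (Fin 3 → R))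
    (h : SpinMaps (g : (CliffordAlgebra (hyperbolicForm R 3))ˣ) x y) :
    suslin y = (spin6EquivSL R g : Matrix (Fin 4) (Fin 4) R) * suslin x *
      suslinStar (spin6EquivSL R g : Matrix (Fin 4) (Fin 4) R) := by
  obtain ⟨B, hB, hB1, -⟩ := suslinRep_of_mem_Spin6 g.2
  exact ((spinMaps_iff hB hB1 x y).1 h).1.symm

theorem spinMaps_basePoint_iff (g : Spin6 R) :
    SpinMaps (g : (CliffordAlgebra (hyperbolicForm R 3))ˣ) (basePoint R) (basePoint R) ↔
      (spin6EquivSL R g : Matrix (Fin 4) (Fin 4) R) * suslinJ R *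
        (spin6EquivSL R g : Matrix (Fin 4) (Fin 4) R)ᵀ = suslinJ R := by
  rw [← mul_suslinStar_self_eq_one_iff]
  constructor
  · intro h
    have := suslin_eq_of_spinMaps g _ _ h
    rw [suslin_basePoint, Matrix.mul_one] at this
    exact this.symm
  · intro h
    -- The image of `e` is known to be some vector `y`, so the block `A` alone identifies it through
    -- `𝒮(y) = 1 = 𝒮(e)`.
    obtain ⟨y, hy⟩ := exists_spinMaps_of_mem g.2 (basePoint R)
    have := suslin_eq_of_spinMaps g _ _ hy
    rw [suslin_basePoint, Matrix.mul_one, h, ← suslin_basePoint] at this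
    rwa [suslin_injective this] at hy

/-! ### `Spin₅` as the stabiliser of the base point, and its isomorphism with `Sp₄`. -/

theorem algebraMap_cliffordAlgebra_hyperbolicForm_injective :
    Function.Injective (algebraMap R (CliffordAlgebra (hyperbolicForm R 3))) := by
  intro r s h
  have := congrArg (suslinRep R) h
  rw [AlgHom.commutes, AlgHom.commutes] at this
  simpa [algebraMap_eq_diagonal] using congrFun (congrFun this (Sum.inl 0)) (Sum.inl 0)

theorem isOrtho_basePoint (y : basePointPerp R) :
    (hyperbolicForm R 3).IsOrtho (basePoint R) (form5Inclusion R y) := by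
  rw [← QuadraticMap.isOrtho_polarBilin]
  exact y.2

theorem form5Units_injective : Function.Injective (form5Units R) :=
  fun _ _ h => Units.ext (map_form5Inclusion_injective (congrArg Units.val h))

theorem commute_basePoint_of_mem_even {a : CliffordAlgebra (form5 R)}
    (ha : a ∈ CliffordAlgebra.evenOdd (form5 R) 0) :
    CliffordAlgebra.ι _ (basePoint R) * CliffordAlgebra.map (form5Inclusion R) a =
      CliffordAlgebra.map (form5Inclusion R) a * CliffordAlgebra.ι _ (basePoint R) := by
  rw [CliffordAlgebra.ι_mul_map_of_isOrtho _ isOrtho_basePoint,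
    CliffordAlgebra.involute_eq_of_mem_even ha]

/-- Fixing `e` already gives `det A = 1`, so stability of all of `H(R³)` follows. It could not be
deduced from stability of `W` and `e`, which need not span when 2 is not invertible. -/
theorem mem_Spin6_of_commute_basePoint {g : (CliffordAlgebra (hyperbolicForm R 3))ˣ}
    (h0 : (g : CliffordAlgebra (hyperbolicForm R 3)) ∈ CliffordAlgebra.evenOdd _ 0)
    (h1 : (g : CliffordAlgebra (hyperbolicForm R 3)) * star (g : CliffordAlgebra _) = 1)
    (he : SpinMaps g (basePoint R) (basePoint R)) : g ∈ Spin6 R := by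
  obtain ⟨A, B, h⟩ := suslinRep_map_evenOdd_zero h0
  have hAB := (mul_star_eq_one_iff_of_suslinRep_eq h).1 h1
  obtain ⟨hA, hB⟩ := (spinMaps_iff h hAB _ _).1 he
  exact mem_Spin6_iff.2 ⟨A, B, h, hAB, det_eq_one_of_basePoint hAB hA hB⟩

/-- The image of `u` fixes `e`, so it preserves `e^⊥ = W`; injectivity of `Cl(W) → Cl(H(R³))` brings
the relation back to `Cl(W)`. -/
theorem exists_spinMaps_form5 {u : (CliffordAlgebra (form5 R))ˣ}
    (hu : form5Units R u ∈ Spin6 R)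
    (he : SpinMaps (form5Units R u) (basePoint R) (basePoint R)) (x : basePointPerp R) :
    ∃ y, SpinMaps u x y := by
  obtain ⟨z, hz⟩ := exists_spinMaps_of_mem hu (form5Inclusion R x)
  have hzW : z ∈ basePointPerp R := by
    change QuadraticMap.polar (hyperbolicForm R 3) (basePoint R) z = 0
    apply algebraMap_cliffordAlgebra_hyperbolicForm_injective
    rw [map_zero, ← CliffordAlgebra.ι_mul_ι_add_swap, ← hz]
    exact mul_conj_add_conj_mul_eq_zero (spinMaps_self_iff.1 he)
      (CliffordAlgebra.ι_mul_ι_add_swap_of_isOrtho (isOrtho_basePoint x))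
  refine ⟨⟨z, hzW⟩, map_form5Inclusion_injective ?_⟩
  rw [map_mul, map_mul, CliffordAlgebra.map_apply_ι, CliffordAlgebra.map_apply_ι]
  refine Eq.trans ?_ hz
  rw [← map_inv]
  rfl

theorem exists_form5_of_commute {x : CliffordAlgebra (hyperbolicForm R 3)}
    (hx : x ∈ CliffordAlgebra.evenOdd _ 0)
    (hc : CliffordAlgebra.ι _ (basePoint R) * x = x * CliffordAlgebra.ι _ (basePoint R)) :
    ∃ a ∈ CliffordAlgebra.evenOdd (form5 R) 0, CliffordAlgebra.map (form5Inclusion R) a = x :=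
  CliffordAlgebra.exists_even_map_eq_of_commute (form5Inclusion R) (v := (![1, 0, 0], 0))
    isOrtho_basePoint (by rw [polar_basePoint]; simp) exists_eq_form5Inclusion_add_smul hx hc

/-- `Spin₅` is the stabiliser of the base point in `Spin₆`. -/
theorem mem_map_form5Units_iff (g : (CliffordAlgebra (hyperbolicForm R 3))ˣ) :
    g ∈ (Spin5 R).map (form5Units R) ↔
      g ∈ Spin6 R ∧ SpinMaps g (basePoint R) (basePoint R) := by
  constructor
  · rintro ⟨u, hu, rfl⟩
    have he : SpinMaps (form5Units R u) (basePoint R) (basePoint R) :=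
      spinMaps_self_iff.2 (commute_basePoint_of_mem_even hu.1)
    refine ⟨mem_Spin6_of_commute_basePoint (CliffordAlgebra.map_mem_evenOdd _ hu.1) ?_ he, he⟩
    change CliffordAlgebra.map (form5Inclusion R) u *
      star (CliffordAlgebra.map (form5Inclusion R) (u : CliffordAlgebra (form5 R))) = 1
    rw [CliffordAlgebra.star_map, ← map_mul, hu.2.1, map_one]
  · rintro ⟨hg, he⟩
    have hg' : g⁻¹ ∈ Spin6 R := inv_mem hg
    have hc := spinMaps_self_iff.1 he
    obtain ⟨a, ha, hag⟩ := exists_form5_of_commute hg.1 hc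
    -- The inverse fixes `e` too, so it lifts as well; this makes the lift of `g` a unit of `Cl(W)`.
    obtain ⟨b, hb, hbg⟩ := exists_form5_of_commute hg'.1 (spinMaps_self_iff.1 he.inv)
    let u : (CliffordAlgebra (form5 R))ˣ :=
      ⟨a, b, map_form5Inclusion_injective (by rw [map_mul, hag, hbg, map_one, Units.mul_inv]),
        map_form5Inclusion_injective (by rw [map_mul, hag, hbg, map_one, Units.inv_mul])⟩
    have hu : form5Units R u = g := Units.ext hag
    have hu' : form5Units R u⁻¹ = g⁻¹ := by rw [map_inv, hu]
    refine ⟨u, ⟨ha, map_form5Inclusion_injective ?_, image_conj_range_ι_eq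
      (exists_spinMaps_form5 (hu ▸ hg) (hu ▸ he))
      (exists_spinMaps_form5 (hu' ▸ hg') (hu' ▸ he.inv))⟩, hu⟩
    change CliffordAlgebra.map (form5Inclusion R) (a * star a) = _
    rw [map_mul, ← CliffordAlgebra.star_map, hag, map_one]
    exact hg.2.1

/-- The relabelling which takes `suslinJ` to the standard alternating matrix. -/
def symplecticIndex : Fin 2 ⊕ Fin 2 ≃ Fin 4 where
  toFun := Sum.elim ![1, 2] ![0, 3]
  invFun := ![Sum.inr 0, Sum.inl 0, Sum.inl 1, Sum.inr 1]
  left_inv := by decide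
  right_inv := by decide

theorem suslinJ_submatrix :
    (suslinJ R).submatrix symplecticIndex symplecticIndex = Matrix.J (Fin 2) R := by
  ext (i | i) (j | j) <;> fin_cases i <;> fin_cases j <;>
    simp [suslinJ, symplecticIndex, Matrix.J]

theorem submatrix_symplecticIndex_injective {α : Type*} : Function.Injective
    fun A : Matrix (Fin 4) (Fin 4) α => A.submatrix symplecticIndex symplecticIndex := by
  intro A B h
  simpa using congrArg (fun M => M.submatrix symplecticIndex.symm symplecticIndex.symm) h

theorem submatrix_mem_symplecticGroup_iff {A : Matrix (Fin 4) (Fin 4) R} :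
    A.submatrix symplecticIndex symplecticIndex ∈ symplecticGroup (Fin 2) R ↔
      A * suslinJ R * Aᵀ = suslinJ R := by
  rw [SymplecticGroup.mem_iff, ← suslinJ_submatrix, transpose_submatrix, submatrix_mul_equiv,
    submatrix_mul_equiv]
  exact submatrix_symplecticIndex_injective.eq_iff

theorem form5Units_mem_Spin6 (u : Spin5 R) :
    form5Units R (u : (CliffordAlgebra (form5 R))ˣ) ∈ Spin6 R :=
  ((mem_map_form5Units_iff _).1 (Subgroup.mem_map_of_mem _ u.2)).1

/-- The inclusion of `Spin₅` in `Spin₆`. -/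
def spin5ToSpin6 (R : Type*) [CommRing R] : Spin5 R →* Spin6 R :=
  ((form5Units R).comp (Spin5 R).subtype).codRestrict (Spin6 R) form5Units_mem_Spin6

/-- The homomorphism `Spin₅ → Sp₄`. -/
noncomputable def spin5ToSp (R : Type*) [CommRing R] :
    Spin5 R →* symplecticGroup (Fin 2) R where
  toFun u := ⟨(spin6EquivSL R (spin5ToSpin6 R u) : Matrix (Fin 4) (Fin 4) R).submatrix
      symplecticIndex symplecticIndex,
    submatrix_mem_symplecticGroup_iff.2 ((spinMaps_basePoint_iff _).1
      ((mem_map_form5Units_iff _).1 (Subgroup.mem_map_of_mem _ u.2)).2)⟩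
  map_one' := Subtype.ext (by simp)
  map_mul' u v := Subtype.ext (by simp [submatrix_mul_equiv])

theorem spin5ToSp_bijective : Function.Bijective (spin5ToSp R) := by
  constructor
  · intro u v h
    have h1 := submatrix_symplecticIndex_injective (congrArg Subtype.val h)
    have h2 : spin5ToSpin6 R u = spin5ToSpin6 R v := (spin6EquivSL R).injective (Subtype.ext h1)
    exact Subtype.ext (form5Units_injective (congrArg Subtype.val h2))
  · rintro ⟨M, hM⟩
    let A : Matrix (Fin 4) (Fin 4) R := M.submatrix symplecticIndex.symm symplecticIndex.symm
    have hAM : A.submatrix symplecticIndex symplecticIndex = M := by simp [A]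
    -- Symplectic matrices have determinant 1, so `A` lies in `SL₄` and comes from `Spin₆`.
    have hA : A.det = 1 := by
      rw [← SymplecticGroup.det_eq_one hM]
      exact det_submatrix_equiv_self _ _
    obtain ⟨g, hg⟩ := (spin6EquivSL R).surjective ⟨A, hA⟩
    have he : SpinMaps (g : (CliffordAlgebra (hyperbolicForm R 3))ˣ) (basePoint R) (basePoint R) := by
      rw [spinMaps_basePoint_iff, hg]
      exact submatrix_mem_symplecticGroup_iff.1 (hAM ▸ hM)
    obtain ⟨u, hu, hug⟩ := (mem_map_form5Units_iff _).2 ⟨g.2, he⟩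
    refine ⟨⟨u, hu⟩, Subtype.ext ?_⟩
    have h1 : spin5ToSpin6 R ⟨u, hu⟩ = g := Subtype.ext hug
    change (spin6EquivSL R (spin5ToSpin6 R ⟨u, hu⟩) : Matrix (Fin 4) (Fin 4) R).submatrix
      symplecticIndex symplecticIndex = M
    rw [h1, hg]
    exact hAM

end Spin

theorem theorem6p2 (R : Type*) [CommRing R] :
    -- the isomorphism with the symplectic group
    Nonempty (Spin5 R ≃* Matrix.symplecticGroup (Fin 2) R) ∧
    -- `Spin₅` is the stabiliser of the base point in `Spin₆`
    Set.InjOn (form5Units R) (Spin5 R) ∧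
    (∀ g : (CliffordAlgebra (hyperbolicForm R 3))ˣ,
      g ∈ (Spin5 R).map (form5Units R) ↔
        g ∈ Spin6 R ∧ SpinMaps g (basePoint R) (basePoint R)) ∧
    -- under `Spin₆ ≅ SL₄`, with action `g • 𝒮 = g 𝒮 g*`, it is the set of `g` with `g J gᵀ = J`
    ∃ ψ : Spin6 R ≃* Matrix.SpecialLinearGroup (Fin 4) R,
      (∀ (g : Spin6 R) (x y : (Fin 3 → R) × (Fin 3 → R)),
        SpinMaps (g : (CliffordAlgebra (hyperbolicForm R 3))ˣ) x y →
          suslin y = (ψ g : Matrix (Fin 4) (Fin 4) R) * suslin x *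
            suslinStar (ψ g : Matrix (Fin 4) (Fin 4) R)) ∧
      ∀ g : Spin6 R,
        SpinMaps (g : (CliffordAlgebra (hyperbolicForm R 3))ˣ) (basePoint R) (basePoint R) ↔
          (ψ g : Matrix (Fin 4) (Fin 4) R) * suslinJ R *
            (ψ g : Matrix (Fin 4) (Fin 4) R)ᵀ = suslinJ R := by
  exact ⟨⟨MulEquiv.ofBijective (spin5ToSp R) spin5ToSp_bijective⟩, form5Units_injective.injOn,
    mem_map_form5Units_iff, spin6EquivSL R, suslin_eq_of_spinMaps, spinMaps_basePoint_iff⟩
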